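/- Let $a,b>0$. There exist constants $C>0$ and $\rho>1$, depending only on $a$ and $b$, such that the following holds for every integer $d\ge 1$. Let $m_1,m_2\in\mathbb R^d$, let $\Sigma_1,\Sigma_2$ be symmetric positive definite $d\times d$ matrices with $aI_d\preceq\Sigma_1,\Sigma_2\preceq bI_d$, and let $G$ be a simple graph on $[d]=\{1,\dots,d\}$ that is a sparsity pattern of both precision matrices: $(\Sigma_1^{-1})_{ij}=(\Sigma_2^{-1})_{ij}=0$ whenever $i\ne j$ and $ij$ is not an edge of $G$. Let $\mu=\mathcal N(m_1,\Sigma_1)$, $\nu=\mathcal N(m_2,\Sigma_2)$, and let $$W_2^2(\mu,\nu)=\inf_{\pi\in\Pi(\mu,\nu)}\int\|x-y\|^2\,d\pi(x,y),$$ where $\Pi(\mu,\nu)$ is the set of measures on $\mathbb R^d\times\mathbb R^d$ with marginals $\mu$ and $\nu$. For a simple graph $\mathcal G$ on $[d]$ (the reference graph), let $[A]_{\mathcal G,0}$ denote the matrix obtained from $A$ by setting to zero all entries $A_{ij}$ with $i\neq j$ and $ij$ not an edge of $\mathcal G$, and let $\mathrm{opt}_{\mathcal G}$ be the optimal value of the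 degree-1 cluster moment relaxation, the semidefinite program $$\min_{Z_1,Z_2,Y}\ \mathrm{Tr}(Z_1)+\mathrm{Tr}(Z_2)-2\,\mathrm{Tr}(Y)$$ over symmetric $Z_1,Z_2\in\mathbb R^{d\times d}$ and arbitrary $Y\in\mathbb R^{d\times d}$, subject to $$[Z_i]_{\mathcal G,0}=[\Sigma_i+m_im_i^\top]_{\mathcal G,0}\ \ (i=1,2),\qquad \begin{bmatrix}1&m_1^\top&m_2^\top\\ m_1&Z_1&Y\\ m_2&Y^\top&Z_2\end{bmatrix}\succeq 0.$$ Then $W_2^2(\mu,\nu)$ is finite, the minimum $\mathrm{opt}_{\mathcal G}$ is attained for every $\mathcal G$, and: (i) if $\mathcal G$ is the complete graph, the relaxation is exact: $\mathrm{opt}_{\mathcal G}=W_2^2(\mu,\nu)$; (ii) for every integer $h\ge 0$, if $\mathcal G=G^h$ is the graph in which two distinct nodes are adjacent if and only if their distance in $G$ is at most $h$, then $$\bigl|\mathrm{opt}_{G^h}-W_2^2(\mu,\nu)\bigr|<C\,d^{3/2}\,\rho^{-h}.$$ -/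

import Mathlib

open MeasureTheory ProbabilityTheory
open scoped ENNReal Matrix

namespace GaussianOT

/-- The set `Π(μ, ν)` of transport plans: measures on the product with marginals `μ` and `ν`. -/
def transportPlans {E : Type*} [MeasurableSpace E] (μ ν : Measure E) : Set (Measure (E × E)) :=
  {π | π.map Prod.fst = μ ∧ π.map Prod.snd = ν}

/-- The squared Wasserstein-2 distance `W₂²(μ, ν) = inf_{π ∈ Π(μ, ν)} ∫ ‖x - y‖² dπ(x, y)`,
the optimal transport value for the quadratic cost, with values in `[0, ∞]`. -/
noncomputable def wassersteinTwoSq {E : Type*} [MeasurableSpace E] [NormedAddCommGroup E]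
    (μ ν : Measure E) : ℝ≥0∞ :=
  ⨅ π ∈ transportPlans μ ν, ∫⁻ p, ENNReal.ofReal (‖p.1 - p.2‖ ^ 2) ∂π

/-- The set `𝕊(G, 0)` of symmetric matrices with sparsity pattern `G`: the off-diagonal entries
at non-edges of `G` vanish. -/
def sparseSymm {d : ℕ} (G : SimpleGraph (Fin d)) : Set (Matrix (Fin d) (Fin d) ℝ) :=
  {X | X.IsSymm ∧ ∀ i j, i ≠ j → ¬ G.Adj i j → X i j = 0}

open Classical in
/-- The orthogonal projection `[A]_{G,0}` of a symmetric matrix onto `𝕊(G, 0)`: keep the entries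
on the diagonal and at the edges of `G`, and set all the others to zero. -/
noncomputable def sparseProj {d : ℕ} (G : SimpleGraph (Fin d)) (A : Matrix (Fin d) (Fin d) ℝ) :
    Matrix (Fin d) (Fin d) ℝ :=
  Matrix.of fun i j => if i = j ∨ G.Adj i j then A i j else 0

/-- The graph `G^h` joining distinct nodes at distance at most `h` in `G`; nodes in different
connected components are at distance `∞`. -/
def graphPower {d : ℕ} (G : SimpleGraph (Fin d)) (h : ℕ) : SimpleGraph (Fin d) where
  Adj i j := i ≠ j ∧ G.edist i j ≤ (h : ℕ∞)
  symm := ⟨fun i j hij => ⟨hij.1.symm, by rw [SimpleGraph.edist_comm]; exact hij.2⟩⟩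
  loopless := ⟨fun _ hi => hi.1 rfl⟩

/-- The matrix `X = [1, m₁ᵀ, m₂ᵀ; m₁, Z₁, Y; m₂, Yᵀ, Z₂]` of size `2d + 1`. -/
def momentMatrix {d : ℕ} (m₁ m₂ : Fin d → ℝ) (Z₁ Z₂ Y : Matrix (Fin d) (Fin d) ℝ) :
    Matrix (Unit ⊕ (Fin d ⊕ Fin d)) (Unit ⊕ (Fin d ⊕ Fin d)) ℝ :=
  Matrix.fromBlocks 1
    (Matrix.fromCols (Matrix.replicateRow Unit m₁) (Matrix.replicateRow Unit m₂))
    (Matrix.fromRows (Matrix.replicateCol Unit m₁) (Matrix.replicateCol Unit m₂))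
    (Matrix.fromBlocks Z₁ Y Yᵀ Z₂)

/-- Feasibility of `(Z₁, Z₂, Y)` for the degree-1 cluster moment relaxation with reference graph
`R`: the second moments of the two marginals are prescribed on the diagonal and on the edges of
`R`, and the full moment matrix is symmetric positive semidefinite. -/
def IsFeasible {d : ℕ} (R : SimpleGraph (Fin d)) (m₁ m₂ : Fin d → ℝ)
    (S₁ S₂ Z₁ Z₂ Y : Matrix (Fin d) (Fin d) ℝ) : Prop :=
  Z₁.IsSymm ∧ Z₂.IsSymm ∧
  sparseProj R Z₁ = sparseProj R (S₁ + Matrix.vecMulVec m₁ m₁) ∧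
  sparseProj R Z₂ = sparseProj R (S₂ + Matrix.vecMulVec m₂ m₂) ∧
  (momentMatrix m₁ m₂ Z₁ Z₂ Y).PosSemidef

/-- The objective values `Tr Z₁ + Tr Z₂ - 2 Tr Y` attained on the feasible set. -/
def relaxationValues {d : ℕ} (R : SimpleGraph (Fin d)) (m₁ m₂ : Fin d → ℝ)
    (S₁ S₂ : Matrix (Fin d) (Fin d) ℝ) : Set ℝ :=
  {v | ∃ Z₁ Z₂ Y : Matrix (Fin d) (Fin d) ℝ, IsFeasible R m₁ m₂ S₁ S₂ Z₁ Z₂ Y ∧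
    v = Z₁.trace + Z₂.trace - 2 * Y.trace}

/-- The optimal value `opt_R` of the degree-1 cluster moment relaxation. -/
noncomputable def relaxationOpt {d : ℕ} (R : SimpleGraph (Fin d)) (m₁ m₂ : Fin d → ℝ)
    (S₁ S₂ : Matrix (Fin d) (Fin d) ℝ) : ℝ :=
  sInf (relaxationValues R m₁ m₂ S₁ S₂)

end GaussianOT

/-!
The squared Wasserstein distance between the two Gaussians is attained by an affine map
`x ↦ m₂ + T (x - m₁)`, where `T` is the positive semidefinite solution of `T Σ₁ T = Σ₂`. With
`V = ‖m₁ - m₂‖² + Tr Σ₁ + Tr Σ₂ - 2 Tr (Σ₁ T)` there are three bounds.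

* `W₂² ≤ V`, by the coupling induced by that map (`wassersteinTwoSq_le`).
* `opt_R ≤ W₂²` for every reference graph `R`, because the second moments of any transport plan are
  feasible (`relaxationOpt_le_toReal_wassersteinTwoSq`).
* `V - loss ≤ opt_R`, by weak duality (`dual_bound`): since `[T, -1; -1, T⁻¹] ⪰ 0`, any matrices
  `L₁ ⪰ T` and `L₂ ⪰ T⁻¹` with sparsity pattern `R` give the lower bound
  `‖m₁ - m₂‖² + Tr Σ₁ + Tr Σ₂ - Tr (Σ₁ L₁) - Tr (Σ₂ L₂)`.

For the complete graph, `L₁ = T` and `L₂ = T⁻¹` are allowed and the loss is zero, so all the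
quantities coincide. For `R = G^h`, put `P = Σ₁⁻¹` and `Q = Σ₂⁻¹`. Then `T = (P Q)^(-1/2) P` and
`T⁻¹ = Q (P Q)^(-1/2)`, where `a² P Q` is similar to a symmetric matrix with spectrum in
`[a² / b², 1]`. Truncating the binomial series of `x^(-1/2)` about `1` after `K` terms approximates
both matrices from below, with error at most `ε = (1 - a² / b²)^K / (a² / b²)` in the Loewner order
(`exists_transport_matrix`). The truncations are polynomials in the sparse matrices `P` and `Q`
that only reach pairs of nodes at distance at most `2 K - 1` in `G` (`supportedWithin_aeval`).
Adding `ε` times the identity makes them admissible as `L₁` and `L₂`, at a loss of at most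
`2 ε b d`. Attainment of the minimum is compactness of the feasible set (`isCompact_feasible`).
-/

namespace GaussianOT

open scoped MatrixOrder

/-! ### Truncated binomial series for the inverse square root -/

/-- The Taylor coefficients `4⁻ⁿ * centralBinom n` of `y ↦ (1 - y)^(-1/2)` at `0`. -/
noncomputable def invSqrtCoeff (n : ℕ) : ℝ := n.centralBinom / 4 ^ n

lemma invSqrtCoeff_nonneg (n : ℕ) : 0 ≤ invSqrtCoeff n := by unfold invSqrtCoeff; positivity

lemma invSqrtCoeff_succ (n : ℕ) :
    2 * ((n + 1) * invSqrtCoeff (n + 1)) = (2 * n + 1) * invSqrtCoeff n := by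
  have h : ((n : ℝ) + 1) * (n + 1).centralBinom = 2 * (2 * n + 1) * n.centralBinom := by
    exact_mod_cast Nat.succ_mul_centralBinom_succ n
  unfold invSqrtCoeff
  rw [pow_succ]
  field_simp
  linear_combination 2 * h

/-- The generating function `F` of `invSqrtCoeff` satisfies `(1 - X) F² = 1`: by the recursion,
`2 (1 - X) F' = F`, so the derivative of `(1 - X) F²` vanishes. -/
lemma one_sub_X_mul_mk_invSqrtCoeff_sq :
    (1 - PowerSeries.X) * PowerSeries.mk invSqrtCoeff ^ 2 = 1 := by
  set F : PowerSeries ℝ := PowerSeries.mk invSqrtCoeff with hF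
  have hode : 2 * ((1 - PowerSeries.X) * PowerSeries.derivative ℝ F) = F := by
    ext n
    have h2 : (2 : PowerSeries ℝ) = PowerSeries.C 2 := (map_ofNat PowerSeries.C 2).symm
    rw [h2, PowerSeries.coeff_C_mul, sub_mul, one_mul, map_sub, PowerSeries.coeff_derivative]
    rcases n with _ | n
    · have := invSqrtCoeff_succ 0
      simp only [hF, PowerSeries.coeff_mk, PowerSeries.coeff_zero_X_mul]
      norm_num at this ⊢
      linarith
    · have := invSqrtCoeff_succ (n + 1)
      rw [PowerSeries.coeff_succ_X_mul, PowerSeries.coeff_derivative]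
      simp only [hF, PowerSeries.coeff_mk]
      push_cast at this ⊢
      linear_combination this
  apply PowerSeries.derivative.ext
  · rw [Derivation.leibniz, Derivation.leibniz_pow]
    simp only [map_sub, Derivation.map_one_eq_zero, PowerSeries.derivative_X, smul_eq_mul,
      nsmul_eq_mul]
    simp only [Nat.cast_ofNat, Nat.add_one_sub_one, pow_one, zero_sub]
    linear_combination F * hode
  · simp [hF, invSqrtCoeff]

lemma sum_antidiagonal_invSqrtCoeff (n : ℕ) :
    ∑ p ∈ Finset.HasAntidiagonal.antidiagonal n, invSqrtCoeff p.1 * invSqrtCoeff p.2 = 1 := by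
  have h1 : PowerSeries.mk invSqrtCoeff ^ 2 = PowerSeries.mk (1 : ℕ → ℝ) := by
    have := PowerSeries.mk_one_mul_one_sub_eq_one ℝ
    calc _ = (PowerSeries.mk 1 * (1 - PowerSeries.X)) * PowerSeries.mk invSqrtCoeff ^ 2 := by
          rw [this, one_mul]
      _ = _ := by rw [mul_assoc, one_sub_X_mul_mk_invSqrtCoeff_sq, mul_one]
  have := congrArg (PowerSeries.coeff n) h1
  rw [sq, PowerSeries.coeff_mul] at this
  simpa using this

/-- The truncated series squared lies between the truncated and the full geometric series. -/
lemma sum_invSqrtCoeff_sq_bounds {y : ℝ} (hy0 : 0 ≤ y) (hy1 : y < 1) (K : ℕ) :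
    (1 - y ^ K) / (1 - y) ≤ (∑ n ∈ Finset.range K, invSqrtCoeff n * y ^ n) ^ 2 ∧
    (∑ n ∈ Finset.range K, invSqrtCoeff n * y ^ n) ^ 2 ≤ 1 / (1 - y) := by
  have hpos : 0 < 1 - y := by linarith
  have hterm (p : ℕ × ℕ) :
      0 ≤ (invSqrtCoeff p.1 * y ^ p.1) * (invSqrtCoeff p.2 * y ^ p.2) := by
    have := invSqrtCoeff_nonneg p.1
    have := invSqrtCoeff_nonneg p.2
    positivity
  -- summing over the triangle `i + j < N` gives the truncated geometric series
  have htri (N : ℕ) : ∑ p ∈ (Finset.range N).sigma fun n => Finset.HasAntidiagonal.antidiagonal n,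
      (invSqrtCoeff p.2.1 * y ^ p.2.1) * (invSqrtCoeff p.2.2 * y ^ p.2.2)
      = (1 - y ^ N) / (1 - y) := by
    rw [Finset.sum_sigma, ← neg_div_neg_eq, neg_sub, neg_sub, ← geom_sum_eq hy1.ne]
    refine Finset.sum_congr rfl fun n _ => ?_
    rw [← mul_one (y ^ n), ← sum_antidiagonal_invSqrtCoeff n, Finset.mul_sum]
    refine Finset.sum_congr rfl fun p hp => ?_
    rw [← Finset.HasAntidiagonal.mem_antidiagonal.1 hp, pow_add]
    ring
  have hsq : (∑ n ∈ Finset.range K, invSqrtCoeff n * y ^ n) ^ 2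
      = ∑ p ∈ Finset.range K ×ˢ Finset.range K,
        (invSqrtCoeff p.1 * y ^ p.1) * (invSqrtCoeff p.2 * y ^ p.2) := by
    rw [sq, Finset.sum_mul_sum, Finset.sum_product]
  have himg (N : ℕ) : ∑ p ∈ (Finset.range N).sigma fun n => Finset.HasAntidiagonal.antidiagonal n,
      (invSqrtCoeff p.2.1 * y ^ p.2.1) * (invSqrtCoeff p.2.2 * y ^ p.2.2)
      = ∑ p ∈ (Finset.range N ×ˢ Finset.range N).filter fun p => p.1 + p.2 < N,
        (invSqrtCoeff p.1 * y ^ p.1) * (invSqrtCoeff p.2 * y ^ p.2) := by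
    refine Finset.sum_bij' (fun p _ => p.2) (fun p _ => ⟨p.1 + p.2, p⟩) ?_ ?_ ?_ ?_ ?_
    · rintro ⟨n, i, j⟩ h
      simp at h ⊢
      omega
    · rintro ⟨i, j⟩ h
      simp at h ⊢
      omega
    · rintro ⟨n, i, j⟩ h
      simp at h ⊢
      omega
    · rintro ⟨i, j⟩ h
      rfl
    · rintro ⟨n, i, j⟩ h
      rfl
  constructor
  · rw [← htri K, himg K, hsq]
    exact Finset.sum_le_sum_of_subset_of_nonneg (Finset.filter_subset _ _)
      fun p _ _ => hterm p
  · calc _ ≤ (1 - y ^ (2 * K)) / (1 - y) := by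
          rw [← htri (2 * K), himg (2 * K), hsq]
          refine Finset.sum_le_sum_of_subset_of_nonneg ?_ fun p _ _ => hterm p
          rintro ⟨i, j⟩ h
          simp at h ⊢
          omega
      _ ≤ _ := by
          gcongr
          linarith [pow_nonneg hy0 (2 * K)]

/-- The polynomial `∑_{n < K} 4⁻ⁿ centralBinom n (1 - X)ⁿ` approximating `x^(-1/2)`. -/
noncomputable def invSqrtPoly (K : ℕ) : Polynomial ℝ :=
  ∑ n ∈ Finset.range K, Polynomial.C (invSqrtCoeff n) * (1 - Polynomial.X) ^ n

lemma invSqrtPoly_bounds {l x : ℝ} (hl : 0 < l) (hx : l ≤ x) (hx1 : x ≤ 1) (K : ℕ) :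
    (invSqrtPoly K).eval x ≤ (√x)⁻¹ ∧ (√x)⁻¹ - (invSqrtPoly K).eval x ≤ (1 - l) ^ K / l := by
  have hx0 : 0 < x := hl.trans_le hx
  have heval : (invSqrtPoly K).eval x
      = ∑ n ∈ Finset.range K, invSqrtCoeff n * (1 - x) ^ n := by
    simp [invSqrtPoly, Polynomial.eval_finsetSum]
  obtain ⟨h1, h2⟩ := sum_invSqrtCoeff_sq_bounds (y := 1 - x) (by linarith) (by linarith) K
  rw [← heval, sub_sub_cancel] at h1 h2
  set s := (invSqrtPoly K).eval x
  have hs : 0 ≤ s := by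
    rw [heval]
    exact Finset.sum_nonneg fun n _ =>
      mul_nonneg (invSqrtCoeff_nonneg n) (pow_nonneg (by linarith) n)
  set r := (√x)⁻¹
  have hr : r ^ 2 = 1 / x := by
    simp only [r, inv_pow, Real.sq_sqrt hx0.le, one_div]
  have hr1 : 1 ≤ r := (one_le_inv₀ (Real.sqrt_pos.2 hx0)).2 (Real.sqrt_le_one.2 hx1)
  have hsr : s ≤ r := by
    rw [← abs_of_nonneg hs, ← abs_of_nonneg (zero_le_one.trans hr1)]
    exact sq_le_sq.1 (h2.trans hr.ge)
  refine ⟨hsr, ?_⟩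
  calc r - s ≤ r ^ 2 - s ^ 2 := by nlinarith
    _ ≤ 1 / x - (1 - (1 - x) ^ K) / x := by rw [hr]; linarith
    _ = (1 - x) ^ K / x := by ring
    _ ≤ (1 - l) ^ K / l := by
      have : 0 ≤ 1 - x := by linarith
      have : 0 ≤ 1 - l := by linarith
      gcongr

/-! ### The inverse square root of a matrix -/

section InverseSqrt

variable {n : Type*} [Fintype n] [DecidableEq n]

lemma _root_.Matrix.PosSemidef.trace_mul_nonneg {A B : Matrix n n ℝ} (hA : A.PosSemidef)
    (hB : B.PosSemidef) : 0 ≤ (A * B).trace := by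
  have h := CFC.sqrt_mul_sqrt_self A hA.nonneg
  have hs : (CFC.sqrt A).IsHermitian := (Matrix.nonneg_iff_posSemidef.1 (CFC.sqrt_nonneg A)).1
  have h2 := (hB.mul_mul_conjTranspose_same (CFC.sqrt A)).trace_nonneg
  rwa [hs.eq, Matrix.trace_mul_comm, ← mul_assoc, h] at h2

/-- If `l ≤ M ≤ 1`, then `R = M^(-1/2)` and the polynomials in `M` that approximate it satisfy
two-sided Loewner bounds; the second pair is the first one multiplied by `M`. -/
lemma exists_inverse_sqrt {M : Matrix n n ℝ} {l : ℝ} (hl : 0 < l) (hMl : l • 1 ≤ M) (hM1 : M ≤ 1) :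
    ∃ R : Matrix n n ℝ, 0 ≤ R ∧ R * R * M = 1 ∧ R * M = M * R ∧
      ∀ K, 0 ≤ R - Polynomial.aeval M (invSqrtPoly K) ∧
        R - Polynomial.aeval M (invSqrtPoly K) ≤ ((1 - l) ^ K / l) • 1 ∧
        0 ≤ M * (R - Polynomial.aeval M (invSqrtPoly K)) ∧
        M * (R - Polynomial.aeval M (invSqrtPoly K)) ≤ ((1 - l) ^ K / l) • M := by
  have hM0 : 0 ≤ M := le_trans (Matrix.PosSemidef.one.smul hl.le).nonneg hMl
  have hM : IsSelfAdjoint M := (Matrix.nonneg_iff_posSemidef.1 hM0).1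
  rw [← Algebra.algebraMap_eq_smul_one, algebraMap_le_iff_le_spectrum hM] at hMl
  rw [← map_one (algebraMap ℝ (Matrix n n ℝ)), le_algebraMap_iff_spectrum_le hM] at hM1
  have hc (f : ℝ → ℝ) : ContinuousOn f (spectrum ℝ M) :=
    (Matrix.finite_real_spectrum (A := M)).continuousOn f
  set g : ℝ → ℝ := fun x => (√x)⁻¹
  have hid : cfc (fun x : ℝ => x) M = M := cfc_id' ℝ M
  have hdiff (K : ℕ) : cfc g M - Polynomial.aeval M (invSqrtPoly K)
      = cfc (fun x => g x - (invSqrtPoly K).eval x) M := by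
    rw [cfc_sub _ _ _ (hc _) (hc _), cfc_polynomial _ _ hM]
  have hMdiff (K : ℕ) : M * (cfc g M - Polynomial.aeval M (invSqrtPoly K))
      = cfc (fun x => x * (g x - (invSqrtPoly K).eval x)) M := by
    rw [hdiff, cfc_mul _ _ _ (hc _) (hc _), hid]
  refine ⟨cfc g M, cfc_nonneg fun x _ => by positivity, ?_, ?_, fun K => ⟨?_, ?_, ?_, ?_⟩⟩
  · nth_rw 3 [← hid]
    rw [← cfc_mul _ _ _ (hc _) (hc _), ← cfc_mul _ _ _ (hc _) (hc _), ← cfc_const_one ℝ M]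
    refine cfc_congr fun x hx => ?_
    have hx0 : 0 < x := hl.trans_le (hMl x hx)
    simp only [g]
    rw [← mul_inv, Real.mul_self_sqrt hx0.le, inv_mul_cancel₀ hx0.ne']
  · nth_rw 2 3 [← hid]
    rw [← cfc_mul _ _ _ (hc _) (hc _), ← cfc_mul _ _ _ (hc _) (hc _)]
    simp_rw [mul_comm]
  · rw [hdiff]
    exact cfc_nonneg fun x hx =>
      sub_nonneg.2 (invSqrtPoly_bounds hl (hMl x hx) (hM1 x hx) K).1
  · rw [hdiff, ← Algebra.algebraMap_eq_smul_one]
    exact cfc_le_algebraMap _ _ _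
      (fun x hx => (invSqrtPoly_bounds hl (hMl x hx) (hM1 x hx) K).2) (hc _) hM
  · rw [hMdiff]
    exact cfc_nonneg fun x hx => mul_nonneg (hl.le.trans (hMl x hx))
      (sub_nonneg.2 (invSqrtPoly_bounds hl (hMl x hx) (hM1 x hx) K).1)
  · rw [hMdiff]
    nth_rw 2 [← hid]
    rw [← cfc_const_mul _ _ _ (hc _)]
    refine cfc_mono (fun x hx => ?_) (hc _) (hc _)
    rw [mul_comm]
    exact mul_le_mul_of_nonneg_right (invSqrtPoly_bounds hl (hMl x hx) (hM1 x hx) K).2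
      (hl.le.trans (hMl x hx))

end InverseSqrt

/-! ### The optimal transport matrix and its sparse approximations -/

section Loewner

lemma conj_le_conj {n : Type*} [Fintype n] {S X Y : Matrix n n ℝ} (hS : S.IsHermitian) (h : X ≤ Y) :
    S * X * S ≤ S * Y * S := by
  have := Matrix.PosSemidef.mul_mul_conjTranspose_same (Matrix.le_iff.1 h) S
  rw [hS.eq, mul_sub, sub_mul] at this
  exact this

lemma smul_le_smul_matrix {n : Type*} {c : ℝ} (hc : 0 ≤ c) {X Y : Matrix n n ℝ} (h : X ≤ Y) :
    c • X ≤ c • Y := by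
  have := (Matrix.le_iff.1 h).smul hc
  rwa [smul_sub] at this

variable {n : Type*} [Fintype n] [DecidableEq n]

/-- A symmetric square root `S` of `A⁻¹`, for `A` positive definite. -/
lemma exists_sqrt_inv {A : Matrix n n ℝ} (hA : A.PosDef) :
    ∃ S : Matrix n n ℝ, S.IsHermitian ∧ S * S = A⁻¹ ∧ S * A * S = 1 ∧ S * S⁻¹ = 1 ∧
      S⁻¹ * S = 1 := by
  set S := CFC.sqrt A⁻¹
  have hS2 : S * S = A⁻¹ := CFC.sqrt_mul_sqrt_self _ hA.inv.posSemidef.nonneg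
  have hAdet : IsUnit A.det := (Matrix.isUnit_iff_isUnit_det _).1 hA.isUnit
  have hdet : IsUnit S.det := by
    have h := congrArg Matrix.det hS2
    rw [Matrix.det_mul] at h
    have h2 : IsUnit (S.det * S.det) :=
      h ▸ (Matrix.isUnit_iff_isUnit_det _).1 hA.inv.isUnit
    exact isUnit_of_mul_isUnit_left h2
  refine ⟨S, (Matrix.nonneg_iff_posSemidef.1 (CFC.sqrt_nonneg _)).1, hS2, ?_,
    Matrix.mul_nonsing_inv _ hdet, Matrix.nonsing_inv_mul _ hdet⟩
  have h1 : S * (S * A) = 1 := by rw [← mul_assoc, hS2, Matrix.nonsing_inv_mul _ hAdet]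
  exact mul_eq_one_comm.1 h1

lemma smul_inv_le_one {A : Matrix n n ℝ} (hA : A.PosDef) {a : ℝ} (h : a • 1 ≤ A) :
    a • A⁻¹ ≤ 1 := by
  obtain ⟨S, hS, hS2, hSA, -⟩ := exists_sqrt_inv hA
  simpa [hS2, hSA] using conj_le_conj hS h

lemma one_le_smul_inv {A : Matrix n n ℝ} (hA : A.PosDef) {b : ℝ} (h : A ≤ b • 1) :
    1 ≤ b • A⁻¹ := by
  obtain ⟨S, hS, hS2, hSA, -⟩ := exists_sqrt_inv hA
  simpa [hS2, hSA] using conj_le_conj hS h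

lemma mul_aeval_of_semiconjBy {S X Y : Matrix n n ℝ} (h : S * X = Y * S) (p : Polynomial ℝ) :
    S * Polynomial.aeval X p = Polynomial.aeval Y p * S := by
  have hpow (k : ℕ) : S * X ^ k = Y ^ k * S := (SemiconjBy.pow_right (show SemiconjBy S X Y from h) k)
  induction p using Polynomial.induction_on' with
  | add p q hp hq => simp [mul_add, add_mul, hp, hq]
  | monomial k c =>
    rw [Polynomial.aeval_monomial, Polynomial.aeval_monomial, Algebra.algebraMap_eq_smul_one]
    simp [hpow]

/-- The positive semidefinite solution `T` of `T A T = B`, with its inverse `U`. With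
`P = A⁻¹`, `Q = B⁻¹`, `S = P^(1/2)` and `M = a² S Q S`, these are `T = a S M^(-1/2) S` and
`U = a⁻¹ S⁻¹ M^(1/2) S⁻¹`. Replacing `M^(-1/2)` by a polynomial `p(M)` gives the approximations
`a p(a² P Q) P` and `a Q p(a² P Q)`, which no longer involve square roots. -/
lemma exists_transport_matrix {A B : Matrix n n ℝ} (hA : A.PosDef) (hB : B.PosDef) {a b : ℝ}
    (ha : 0 < a) (hab : a ≤ b) (hAa : a • 1 ≤ A) (hBa : a • 1 ≤ B) (hAb : A ≤ b • 1)
    (hBb : B ≤ b • 1) :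
    ∃ T U : Matrix n n ℝ, 0 ≤ T ∧ 0 ≤ U ∧ T * U = 1 ∧ T * A * T = B ∧
      ∀ K : ℕ,
        a • (Polynomial.aeval (a ^ 2 • (A⁻¹ * B⁻¹)) (invSqrtPoly K) * A⁻¹) ≤ T ∧
        T ≤ a • (Polynomial.aeval (a ^ 2 • (A⁻¹ * B⁻¹)) (invSqrtPoly K) * A⁻¹) +
          ((1 - a ^ 2 / b ^ 2) ^ K / (a ^ 2 / b ^ 2)) • 1 ∧
        a • (B⁻¹ * Polynomial.aeval (a ^ 2 • (A⁻¹ * B⁻¹)) (invSqrtPoly K)) ≤ U ∧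
        U ≤ a • (B⁻¹ * Polynomial.aeval (a ^ 2 • (A⁻¹ * B⁻¹)) (invSqrtPoly K)) +
          ((1 - a ^ 2 / b ^ 2) ^ K / (a ^ 2 / b ^ 2)) • 1 := by
  have hb : 0 < b := ha.trans_le hab
  obtain ⟨S, hS, hS2, hSA, hSi, hiS⟩ := exists_sqrt_inv hA
  have hSinv : S⁻¹.IsHermitian := hS.inv
  set P := A⁻¹ with hP
  set Q := B⁻¹ with hQ
  have hBQ : B * Q = 1 :=
    Matrix.mul_nonsing_inv _ ((Matrix.isUnit_iff_isUnit_det _).1 hB.isUnit)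
  have haP : a • P ≤ 1 := smul_inv_le_one hA hAa
  have haQ : a • Q ≤ 1 := smul_inv_le_one hB hBa
  have hbP : 1 ≤ b • P := one_le_smul_inv hA hAb
  have hbQ : 1 ≤ b • Q := one_le_smul_inv hB hBb
  set M : Matrix n n ℝ := a ^ 2 • (S * Q * S) with hM
  set l : ℝ := a ^ 2 / b ^ 2 with hl
  have hl0 : 0 < l := by positivity
  have hM1 : M ≤ 1 := by
    have h := smul_le_smul_matrix ha.le (conj_le_conj hS haQ)
    rw [mul_one, hS2] at h
    refine le_trans (le_of_eq ?_) (h.trans haP)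
    rw [hM, Matrix.mul_smul, Matrix.smul_mul, smul_smul, sq]
  have hMl : l • 1 ≤ M := by
    have h := smul_le_smul_matrix hb.le (conj_le_conj hS hbQ)
    rw [mul_one, hS2] at h
    refine (smul_le_smul_matrix hl0.le (hbP.trans h)).trans (le_of_eq ?_)
    rw [hM, Matrix.mul_smul, Matrix.smul_mul, smul_smul, smul_smul]
    congr 1
    rw [hl]
    field_simp
  obtain ⟨R, hR0, hRRM, hRM, hbd⟩ := exists_inverse_sqrt hl0 hMl hM1
  set Y : Matrix n n ℝ := a ^ 2 • (P * Q) with hY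
  have hSM : S * M = Y * S := by
    rw [hM, hY, ← hS2]
    simp only [Matrix.mul_smul, Matrix.smul_mul, mul_assoc]
  have hiY : S⁻¹ * Y = M * S⁻¹ := by
    calc S⁻¹ * Y = S⁻¹ * Y * (S * S⁻¹) := by rw [hSi, mul_one]
      _ = S⁻¹ * (Y * S) * S⁻¹ := by simp only [mul_assoc]
      _ = (S⁻¹ * S) * M * S⁻¹ := by rw [← hSM]; simp only [mul_assoc]
      _ = M * S⁻¹ := by rw [hiS, one_mul]
  have hMS : S⁻¹ * M * S⁻¹ = a ^ 2 • Q := by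
    calc S⁻¹ * M * S⁻¹ = a ^ 2 • ((S⁻¹ * S) * Q * (S * S⁻¹)) := by
          rw [hM]; simp only [Matrix.mul_smul, Matrix.smul_mul, mul_assoc]
      _ = a ^ 2 • Q := by rw [hiS, hSi, one_mul, mul_one]
  have hTK (K : ℕ) : a • (S * Polynomial.aeval M (invSqrtPoly K) * S)
      = a • (Polynomial.aeval Y (invSqrtPoly K) * P) := by
    rw [mul_aeval_of_semiconjBy hSM, mul_assoc, hS2]
  have hUK (K : ℕ) : a⁻¹ • (S⁻¹ * (M * Polynomial.aeval M (invSqrtPoly K)) * S⁻¹)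
      = a • (Q * Polynomial.aeval Y (invSqrtPoly K)) := by
    rw [mul_assoc, mul_assoc, ← mul_aeval_of_semiconjBy hiY, ← mul_assoc, ← mul_assoc, hMS,
      Matrix.smul_mul, smul_smul]
    congr 1
    field_simp
  have hai : 0 ≤ a⁻¹ := (inv_pos.2 ha).le
  have hMR0 : 0 ≤ M * R := by
    have h := (hbd 0).2.2.1
    simpa [invSqrtPoly] using h
  refine ⟨a • (S * R * S), a⁻¹ • (S⁻¹ * (M * R) * S⁻¹), ?_, ?_, ?_, ?_, fun K => ?_⟩
  · simpa using smul_le_smul_matrix ha.le (conj_le_conj hS hR0)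
  · simpa using smul_le_smul_matrix hai (conj_le_conj hSinv hMR0)
  · rw [Matrix.smul_mul, Matrix.mul_smul, smul_smul, mul_inv_cancel₀ ha.ne', one_smul]
    calc S * R * S * (S⁻¹ * (M * R) * S⁻¹) = S * R * (S * S⁻¹) * (M * R) * S⁻¹ := by
          simp only [mul_assoc]
      _ = S * (R * R * M) * S⁻¹ := by rw [hSi, ← hRM]; simp only [mul_one, mul_assoc]
      _ = 1 := by rw [hRRM, mul_one, hSi]
  · have h1 : a • (S * R * S) * A * (a • (S * R * S)) = a ^ 2 • (S * (R * R) * S) := by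
      calc _ = a ^ 2 • (S * R * (S * A * S) * (R * S)) := by
            simp only [Matrix.smul_mul, Matrix.mul_smul, smul_smul, mul_assoc, sq]
        _ = _ := by rw [hSA]; simp only [mul_one, mul_assoc]
    have h2 : a ^ 2 • (S * (R * R) * S) * Q = 1 := by
      calc _ = S * (R * R * (a ^ 2 • (S * Q * S))) * S⁻¹ := by
            simp only [Matrix.smul_mul, Matrix.mul_smul, mul_assoc, hSi, mul_one]
        _ = 1 := by rw [← hM, hRRM, mul_one, hSi]
    rw [h1]
    calc _ = a ^ 2 • (S * (R * R) * S) * (Q * B) := by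
          rw [mul_eq_one_comm.1 hBQ, mul_one]
      _ = B := by rw [← mul_assoc, h2, one_mul]
  · obtain ⟨h1, h2, h3, h4⟩ := hbd K
    set ε := (1 - l) ^ K / l
    have hε : 0 ≤ ε := by
      have hl1 : l ≤ 1 := (div_le_one (by positivity)).2 (pow_le_pow_left₀ ha.le hab 2)
      exact div_nonneg (pow_nonneg (sub_nonneg.2 hl1) K) hl0.le
    rw [← hTK, ← hUK]
    rw [sub_nonneg] at h1
    rw [mul_sub, sub_nonneg] at h3
    rw [sub_le_iff_le_add'] at h2
    rw [mul_sub, sub_le_iff_le_add'] at h4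
    refine ⟨smul_le_smul_matrix ha.le (conj_le_conj hS h1), ?_,
      smul_le_smul_matrix hai (conj_le_conj hSinv h3), ?_⟩
    · refine (smul_le_smul_matrix ha.le (conj_le_conj hS h2)).trans ?_
      rw [mul_add, add_mul, smul_add]
      gcongr
      rw [Matrix.mul_smul, Matrix.smul_mul, mul_one, hS2, smul_comm]
      exact smul_le_smul_matrix hε haP
    · refine (smul_le_smul_matrix hai (conj_le_conj hSinv h4)).trans ?_
      rw [mul_add, add_mul, smul_add]
      gcongr
      rw [Matrix.mul_smul, Matrix.smul_mul, hMS, smul_smul, smul_smul]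
      convert smul_le_smul_matrix hε haQ using 1
      rw [smul_smul]
      congr 1
      field_simp

end Loewner

/-! ### Matrices supported within a given graph distance -/

/-- The entries of `M` vanish at pairs of nodes whose distance in `G` exceeds `r`. -/
def SupportedWithin {V : Type*} (G : SimpleGraph V) (r : ℕ) (M : Matrix V V ℝ) : Prop :=
  ∀ i j, M i j ≠ 0 → G.edist i j ≤ r

namespace SupportedWithin

variable {V : Type*} {G : SimpleGraph V} {r s : ℕ} {M N : Matrix V V ℝ}

lemma mono (hM : SupportedWithin G r M) (h : r ≤ s) : SupportedWithin G s M :=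
  fun i j hij => (hM i j hij).trans (by exact_mod_cast h)

lemma one [DecidableEq V] : SupportedWithin G 0 (1 : Matrix V V ℝ) := by
  intro i j h
  obtain rfl : i = j := by
    by_contra hij
    exact h (Matrix.one_apply_ne hij)
  simp

lemma add (hM : SupportedWithin G r M) (hN : SupportedWithin G r N) :
    SupportedWithin G r (M + N) := by
  intro i j h
  by_cases h1 : M i j = 0
  · exact hN i j fun h2 => h (by simp [h1, h2])
  · exact hM i j h1

lemma smul (hM : SupportedWithin G r M) (c : ℝ) : SupportedWithin G r (c • M) :=
  fun i j h => hM i j fun h0 => h (by simp [h0])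

lemma sub (hM : SupportedWithin G r M) (hN : SupportedWithin G r N) :
    SupportedWithin G r (M - N) := by
  simpa [sub_eq_add_neg] using hM.add (hN.smul (-1))

lemma mul [Fintype V] (hM : SupportedWithin G r M) (hN : SupportedWithin G s N) :
    SupportedWithin G (r + s) (M * N) := by
  intro i j h
  rw [Matrix.mul_apply] at h
  obtain ⟨k, -, hk⟩ := Finset.exists_ne_zero_of_sum_ne_zero h
  push_cast
  exact G.edist_triangle.trans
    (add_le_add (hM i k (left_ne_zero_of_mul hk)) (hN k j (right_ne_zero_of_mul hk)))

lemma pow [Fintype V] [DecidableEq V] (hM : SupportedWithin G r M) (k : ℕ) :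
    SupportedWithin G (k * r) (M ^ k) := by
  induction k with
  | zero => simpa using one
  | succ k ih =>
    rw [pow_succ, add_mul, one_mul]
    exact ih.mul hM

lemma sum {ι : Type*} (s : Finset ι) {F : ι → Matrix V V ℝ}
    (h : ∀ i ∈ s, SupportedWithin G r (F i)) : SupportedWithin G r (∑ i ∈ s, F i) := by
  intro i j hij
  rw [Matrix.sum_apply] at hij
  obtain ⟨k, hk, hne⟩ := Finset.exists_ne_zero_of_sum_ne_zero hij
  exact h k hk i j hne

end SupportedWithin

variable {d : ℕ} {G : SimpleGraph (Fin d)}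

lemma supportedWithin_one_of_mem_sparseSymm {X : Matrix (Fin d) (Fin d) ℝ}
    (hX : X ∈ sparseSymm G) : SupportedWithin G 1 X := by
  intro i j h
  by_cases hij : i = j
  · simp [hij]
  · have hadj : G.Adj i j := by
      by_contra hn
      exact h (hX.2 i j hij hn)
    simp [SimpleGraph.edist_eq_one_iff_adj.2 hadj]

lemma aeval_invSqrtPoly {n : Type*} [Fintype n] [DecidableEq n] (Y : Matrix n n ℝ) (K : ℕ) :
    Polynomial.aeval Y (invSqrtPoly K)
      = ∑ k ∈ Finset.range K, invSqrtCoeff k • (1 - Y) ^ k := by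
  simp [invSqrtPoly, Algebra.algebraMap_eq_smul_one]

/-- The product of two matrices supported on the edges reaches distance two, so a polynomial of
degree less than `K` in it reaches distance `2 K - 2`, and one further factor adds one. -/
lemma supportedWithin_aeval {P Q X : Matrix (Fin d) (Fin d) ℝ} (hP : SupportedWithin G 1 P)
    (hQ : SupportedWithin G 1 Q) (hX : SupportedWithin G 1 X) (c : ℝ) {K h : ℕ}
    (hK : 2 * K ≤ h + 1) :
    SupportedWithin G h (Polynomial.aeval (c • (P * Q)) (invSqrtPoly K) * X) ∧
    SupportedWithin G h (X * Polynomial.aeval (c • (P * Q)) (invSqrtPoly K)) := by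
  rw [aeval_invSqrtPoly, Finset.sum_mul, Finset.mul_sum]
  have hY : SupportedWithin G 2 (1 - c • (P * Q)) :=
    (SupportedWithin.one.mono zero_le_two).sub ((hP.mul hQ).smul c)
  refine ⟨SupportedWithin.sum _ fun k hk => ?_, SupportedWithin.sum _ fun k hk => ?_⟩ <;>
    rw [Finset.mem_range] at hk
  · exact (((hY.pow k).smul _).mul hX).mono (by omega)
  · exact (hX.mul ((hY.pow k).smul _)).mono (by omega)

/-! ### Weak duality for the relaxation -/

lemma momentMatrix_eq {d : ℕ} (m₁ m₂ : Fin d → ℝ) (Z₁ Z₂ Y : Matrix (Fin d) (Fin d) ℝ) :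
    momentMatrix m₁ m₂ Z₁ Z₂ Y = Matrix.fromBlocks 1
      (Matrix.replicateRow Unit (Sum.elim m₁ m₂)) (Matrix.replicateRow Unit (Sum.elim m₁ m₂))ᴴ
      (Matrix.fromBlocks Z₁ Y Yᵀ Z₂) := by
  ext (i | i | i) (j | j | j) <;> simp [momentMatrix]

/-- The Schur complement of the moment matrix is the block matrix of centred second moments. -/
lemma posSemidef_centred_of_momentMatrix {d : ℕ} {m₁ m₂ : Fin d → ℝ}
    {Z₁ Z₂ Y : Matrix (Fin d) (Fin d) ℝ} (h : (momentMatrix m₁ m₂ Z₁ Z₂ Y).PosSemidef) :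
    (Matrix.fromBlocks (Z₁ - Matrix.vecMulVec m₁ m₁) (Y - Matrix.vecMulVec m₁ m₂)
      (Y - Matrix.vecMulVec m₁ m₂)ᵀ (Z₂ - Matrix.vecMulVec m₂ m₂)).PosSemidef := by
  let _ : Invertible (1 : Matrix Unit Unit ℝ) := invertibleOne
  rw [momentMatrix_eq, Matrix.PosDef.fromBlocks₁₁ _ _ Matrix.PosDef.one] at h
  refine (congrArg Matrix.PosSemidef ?_).mpr h
  ext (i | i) (j | j) <;> simp [Matrix.mul_apply, Matrix.vecMulVec_apply, mul_comm]

/-- The dual certificate `[T, -1; -1, T⁻¹] ⪰ 0`. -/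
lemma posSemidef_certificate {n : Type*} [Fintype n] [DecidableEq n] {T U : Matrix n n ℝ}
    (hT : 0 ≤ T) (hTU : T * U = 1) : (Matrix.fromBlocks T (-1) (-1) U).PosSemidef := by
  have hTdef : T.PosDef :=
    (Matrix.nonneg_iff_posSemidef.1 hT).posDef_iff_isUnit.2
      (IsUnit.of_mul_eq_one U hTU)
  let _ := hTdef.isUnit.invertible
  have h := (Matrix.PosDef.fromBlocks₁₁ (-1 : Matrix n n ℝ) U hTdef).2 (by
    rw [Matrix.inv_eq_right_inv hTU]
    simpa using Matrix.PosSemidef.zero)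
  simpa using h

/-- Moment matching on the edges of `R` determines traces against matrices with pattern `R`. -/
lemma trace_mul_eq_of_sparseProj_eq {d : ℕ} {R : SimpleGraph (Fin d)} {m : Fin d → ℝ}
    {A Z L : Matrix (Fin d) (Fin d) ℝ}
    (hZ : sparseProj R Z = sparseProj R (A + Matrix.vecMulVec m m))
    (hL : ∀ i j, i ≠ j → ¬ R.Adj i j → L i j = 0) :
    ((Z - Matrix.vecMulVec m m) * L).trace = (A * L).trace := by
  simp only [Matrix.trace, Matrix.diag_apply, Matrix.mul_apply]
  refine Finset.sum_congr rfl fun i _ => Finset.sum_congr rfl fun j _ => ?_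
  by_cases hij : i = j ∨ R.Adj i j
  · have h := congrFun (congrFun hZ i) j
    simp only [sparseProj, Matrix.of_apply, if_pos hij, Matrix.add_apply] at h
    simp [h]
  · rw [not_or] at hij
    rw [hL j i (Ne.symm hij.1) fun h => hij.2 h.symm, mul_zero, mul_zero]

/-- Any pair of matrices with pattern `R` above `T` and `T⁻¹` bounds the relaxation from below. -/
lemma dual_bound {d : ℕ} {R : SimpleGraph (Fin d)} {m₁ m₂ : Fin d → ℝ}
    {A B Z₁ Z₂ Y T U L₁ L₂ : Matrix (Fin d) (Fin d) ℝ}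
    (hf : IsFeasible R m₁ m₂ A B Z₁ Z₂ Y) (hT : 0 ≤ T) (hTU : T * U = 1)
    (hT₁ : T ≤ L₁) (hU₂ : U ≤ L₂)
    (hL₁ : ∀ i j, i ≠ j → ¬ R.Adj i j → L₁ i j = 0)
    (hL₂ : ∀ i j, i ≠ j → ¬ R.Adj i j → L₂ i j = 0) :
    (m₁ - m₂) ⬝ᵥ (m₁ - m₂) + A.trace + B.trace - (A * L₁).trace - (B * L₂).trace ≤
      Z₁.trace + Z₂.trace - 2 * Y.trace := by
  obtain ⟨-, -, h1, h2, hX⟩ := hf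
  have hD := posSemidef_centred_of_momentMatrix hX
  have hC₁ : (Z₁ - Matrix.vecMulVec m₁ m₁).PosSemidef := hD.submatrix Sum.inl
  have hC₂ : (Z₂ - Matrix.vecMulVec m₂ m₂).PosSemidef := hD.submatrix Sum.inr
  have hcert := hD.trace_mul_nonneg (posSemidef_certificate hT hTU)
  rw [Matrix.fromBlocks_multiply] at hcert
  simp only [Matrix.trace, Matrix.diag_apply, Fintype.sum_sum_type, Matrix.fromBlocks_apply₁₁,
    Matrix.fromBlocks_apply₂₂] at hcert
  change 0 ≤ Matrix.trace _ + Matrix.trace _ at hcert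
  have e1 := hC₁.trace_mul_nonneg (Matrix.le_iff.1 hT₁)
  have e2 := hC₂.trace_mul_nonneg (Matrix.le_iff.1 hU₂)
  rw [mul_sub, Matrix.trace_sub, trace_mul_eq_of_sparseProj_eq h1 hL₁] at e1
  rw [mul_sub, Matrix.trace_sub, trace_mul_eq_of_sparseProj_eq h2 hL₂] at e2
  have t1 : Z₁.trace = A.trace + m₁ ⬝ᵥ m₁ := by
    have := trace_mul_eq_of_sparseProj_eq h1 (L := 1) fun i j hij _ => Matrix.one_apply_ne hij
    rw [mul_one, mul_one, Matrix.trace_sub, Matrix.trace_vecMulVec] at this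
    linarith
  have t2 : Z₂.trace = B.trace + m₂ ⬝ᵥ m₂ := by
    have := trace_mul_eq_of_sparseProj_eq h2 (L := 1) fun i j hij _ => Matrix.one_apply_ne hij
    rw [mul_one, mul_one, Matrix.trace_sub, Matrix.trace_vecMulVec] at this
    linarith
  have t3 : (m₁ - m₂) ⬝ᵥ (m₁ - m₂) = m₁ ⬝ᵥ m₁ + m₂ ⬝ᵥ m₂ - 2 * (m₁ ⬝ᵥ m₂) := by
    rw [sub_dotProduct, dotProduct_sub, dotProduct_sub, dotProduct_comm m₂ m₁]
    ring
  simp only [Matrix.trace_add, mul_neg, mul_one, Matrix.trace_neg, Matrix.trace_transpose,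
    Matrix.trace_sub, Matrix.trace_vecMulVec] at hcert
  rw [t1, t2, t3]
  linarith

/-! ### Attainment of the minimum -/

lemma _root_.Matrix.PosSemidef.abs_apply_le {n : Type*} [Fintype n] [DecidableEq n]
    {X : Matrix n n ℝ} (hX : X.PosSemidef) (i j : n) : |X i j| ≤ (X i i + X j j) / 2 := by
  have hsymm : X j i = X i j := by simpa using hX.1.apply i j
  have hp := hX.dotProduct_mulVec_nonneg (Pi.single i 1 + Pi.single j 1)
  have hm := hX.dotProduct_mulVec_nonneg (Pi.single i 1 - Pi.single j 1)
  simp [Matrix.mulVec_add, Matrix.mulVec_sub, hsymm] at hp hm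
  rw [abs_le]
  constructor <;> linarith

lemma isClosed_setOf_posSemidef {n : Type*} [Fintype n] :
    IsClosed {X : Matrix n n ℝ | X.PosSemidef} := by
  simp only [Matrix.posSemidef_iff_dotProduct_mulVec, Matrix.IsHermitian, Set.ofPred_and,
    Set.ofPred_forall]
  refine (isClosed_eq (by fun_prop) continuous_id).inter (isClosed_iInter fun x => ?_)
  exact isClosed_le continuous_const (by fun_prop)

lemma isCompact_setOf_abs_apply_le {n : Type*} (c : n → n → ℝ) :
    IsCompact {X : Matrix n n ℝ | ∀ i j, |X i j| ≤ c i j} := by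
  have h : IsCompact (Set.univ.pi fun i => Set.univ.pi fun j => Set.Icc (-c i j) (c i j)) :=
    isCompact_univ_pi fun i => isCompact_univ_pi fun j => isCompact_Icc
  change IsCompact {X : n → n → ℝ | ∀ i j, |X i j| ≤ c i j}
  convert h using 1
  ext X
  simp only [Set.mem_ofPred_eq, abs_le, Set.mem_pi, Set.mem_univ, forall_const, Set.mem_Icc]

lemma diag_eq_of_sparseProj_eq {d : ℕ} {R : SimpleGraph (Fin d)}
    {Z Z' : Matrix (Fin d) (Fin d) ℝ} (h : sparseProj R Z = sparseProj R Z') (i : Fin d) :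
    Z i i = Z' i i := by
  simpa [sparseProj] using congrFun (congrFun h i) i

lemma continuous_sparseProj {d : ℕ} (R : SimpleGraph (Fin d)) : Continuous (sparseProj R) := by
  refine continuous_matrix fun i j => ?_
  by_cases h : i = j ∨ R.Adj i j
  · simpa [sparseProj, h] using continuous_id.matrix_elem i j
  · simpa [sparseProj, h] using continuous_const

lemma continuous_momentMatrix {d : ℕ} (m₁ m₂ : Fin d → ℝ) :
    Continuous fun p : Matrix (Fin d) (Fin d) ℝ × Matrix (Fin d) (Fin d) ℝ ×
      Matrix (Fin d) (Fin d) ℝ => momentMatrix m₁ m₂ p.1 p.2.1 p.2.2 := by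
  unfold momentMatrix
  fun_prop

/-- The feasible set is compact: the diagonals of `Z₁` and `Z₂` are prescribed, and they bound all
the entries of a positive semidefinite moment matrix. -/
lemma isCompact_feasible {d : ℕ} (R : SimpleGraph (Fin d)) (m₁ m₂ : Fin d → ℝ)
    (A B : Matrix (Fin d) (Fin d) ℝ) :
    IsCompact {p : Matrix (Fin d) (Fin d) ℝ × Matrix (Fin d) (Fin d) ℝ ×
      Matrix (Fin d) (Fin d) ℝ | IsFeasible R m₁ m₂ A B p.1 p.2.1 p.2.2} := by
  set A' := A + Matrix.vecMulVec m₁ m₁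
  set B' := B + Matrix.vecMulVec m₂ m₂
  refine IsCompact.of_isClosed_subset
    ((isCompact_setOf_abs_apply_le fun i j => (A' i i + A' j j) / 2).prod
      ((isCompact_setOf_abs_apply_le fun i j => (B' i i + B' j j) / 2).prod
        (isCompact_setOf_abs_apply_le fun i j => (A' i i + B' j j) / 2))) ?_ ?_
  · simp only [IsFeasible, Set.ofPred_and]
    have c1 := continuous_sparseProj R
    refine IsClosed.inter (isClosed_eq (by fun_prop) (by fun_prop)) (IsClosed.inter
      (isClosed_eq (by fun_prop) (by fun_prop)) (IsClosed.inter
      (isClosed_eq (by fun_prop) (by fun_prop)) (IsClosed.inter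
      (isClosed_eq (by fun_prop) (by fun_prop)) ?_)))
    exact isClosed_setOf_posSemidef.preimage (continuous_momentMatrix m₁ m₂)
  · rintro ⟨Z₁, Z₂, Y⟩ ⟨-, -, h1, h2, hX⟩
    have d1 : ∀ i, Z₁ i i = A' i i := diag_eq_of_sparseProj_eq h1
    have d2 : ∀ i, Z₂ i i = B' i i := diag_eq_of_sparseProj_eq h2
    have b1 (i j) : |Z₁ i j| ≤ (A' i i + A' j j) / 2 := by
      rw [← d1 i, ← d1 j]
      exact hX.abs_apply_le (Sum.inr (Sum.inl i)) (Sum.inr (Sum.inl j))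
    have b2 (i j) : |Z₂ i j| ≤ (B' i i + B' j j) / 2 := by
      rw [← d2 i, ← d2 j]
      exact hX.abs_apply_le (Sum.inr (Sum.inr i)) (Sum.inr (Sum.inr j))
    have b3 (i j) : |Y i j| ≤ (A' i i + B' j j) / 2 := by
      rw [← d1 i, ← d2 j]
      exact hX.abs_apply_le (Sum.inr (Sum.inl i)) (Sum.inr (Sum.inr j))
    exact ⟨b1, b2, b3⟩

lemma isLeast_relaxationOpt {d : ℕ} {R : SimpleGraph (Fin d)} {m₁ m₂ : Fin d → ℝ}
    {A B : Matrix (Fin d) (Fin d) ℝ} (h : (relaxationValues R m₁ m₂ A B).Nonempty) :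
    IsLeast (relaxationValues R m₁ m₂ A B) (relaxationOpt R m₁ m₂ A B) := by
  refine IsCompact.isLeast_sInf ?_ h
  have hc := (isCompact_feasible R m₁ m₂ A B).image
    (f := fun p => p.1.trace + p.2.1.trace - 2 * p.2.2.trace) (by fun_prop)
  convert hc using 1
  ext v
  constructor
  · rintro ⟨Z₁, Z₂, Y, hf, rfl⟩
    exact ⟨(Z₁, Z₂, Y), hf, rfl⟩
  · rintro ⟨⟨Z₁, Z₂, Y⟩, hf, rfl⟩
    exact ⟨Z₁, Z₂, Y, hf, rfl⟩

/-! ### Transport plans between Gaussian measures -/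

section Moments

variable {d : ℕ} {m : EuclideanSpace ℝ (Fin d)} {A : Matrix (Fin d) (Fin d) ℝ}

lemma memLp_eval_multivariateGaussian (i : Fin d) :
    MemLp (fun x : EuclideanSpace ℝ (Fin d) => x i) 2 (multivariateGaussian m A) :=
  MemLp.eval_piLp (f := id) IsGaussian.memLp_two_id i

lemma integral_eval_multivariateGaussian (i : Fin d) :
    ∫ x, x i ∂multivariateGaussian m A = m i := by
  have h := ContinuousLinearMap.integral_comp_id_comm
    (IsGaussian.integrable_id (μ := multivariateGaussian m A))
    (EuclideanSpace.proj (𝕜 := ℝ) i)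
  simpa using h

lemma integral_eval_mul_eval_multivariateGaussian (hA : A.PosSemidef) (i j : Fin d) :
    ∫ x, x i * x j ∂multivariateGaussian m A = (A + Matrix.vecMulVec m.ofLp m.ofLp) i j := by
  have h := covariance_eq_sub (memLp_eval_multivariateGaussian (m := m) (A := A) i)
    (memLp_eval_multivariateGaussian j)
  rw [covariance_eval_multivariateGaussian hA, integral_eval_multivariateGaussian,
    integral_eval_multivariateGaussian] at h
  simp only [Pi.mul_apply] at h
  simp [Matrix.vecMulVec_apply, h]

end Moments

lemma posSemidef_of_integral_mul {Ω ι : Type*} [MeasurableSpace Ω] [Fintype ι] {π : Measure Ω}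
    {f : ι → Ω → ℝ} (hf : ∀ i, MemLp (f i) 2 π) {X : Matrix ι ι ℝ}
    (hX : ∀ i j, X i j = ∫ ω, f i ω * f j ω ∂π) : X.PosSemidef := by
  rw [Matrix.posSemidef_iff_dotProduct_mulVec]
  refine ⟨?_, fun v => ?_⟩
  · ext i j
    simp [hX, mul_comm]
  · have hint (i j : ι) : Integrable (fun ω => (v i * f i ω) * (v j * f j ω)) π :=
      ((hf i).const_mul (v i)).integrable_mul ((hf j).const_mul (v j))
    have h : star v ⬝ᵥ X *ᵥ v = ∫ ω, (∑ i, v i * f i ω) ^ 2 ∂π := by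
      simp_rw [sq, Finset.sum_mul_sum]
      rw [integral_finsetSum _ fun i _ => integrable_finsetSum _ fun j _ => hint i j]
      simp only [dotProduct, Matrix.mulVec, Finset.mul_sum]
      refine Finset.sum_congr rfl fun i _ => ?_
      rw [integral_finsetSum _ fun j _ => hint i j]
      refine Finset.sum_congr rfl fun j _ => ?_
      rw [hX, ← integral_mul_const, ← integral_const_mul]
      refine integral_congr_ae (Filter.Eventually.of_forall fun ω => ?_)
      simp only [Pi.star_apply, star_trivial]
      ring
    rw [h]
    exact integral_nonneg fun ω => sq_nonneg _

section Couplings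

variable {d : ℕ} {m₁ m₂ : EuclideanSpace ℝ (Fin d)} {A B : Matrix (Fin d) (Fin d) ℝ}
  {π : Measure (EuclideanSpace ℝ (Fin d) × EuclideanSpace ℝ (Fin d))}

/-- The cross moments `E[xᵢ yⱼ]` of a measure on a product. -/
noncomputable def crossMoments
    (π : Measure (EuclideanSpace ℝ (Fin d) × EuclideanSpace ℝ (Fin d))) :
    Matrix (Fin d) (Fin d) ℝ :=
  Matrix.of fun i j => ∫ p, p.1 i * p.2 j ∂π

lemma memLp_fst_of_mem_transportPlans
    (hπ : π ∈ transportPlans (multivariateGaussian m₁ A) (multivariateGaussian m₂ B))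
    (i : Fin d) : MemLp (fun p => p.1 i) 2 π := by
  have h := memLp_eval_multivariateGaussian (m := m₁) (A := A) i
  rw [← hπ.1] at h
  exact (memLp_map_measure_iff h.1 measurable_fst.aemeasurable).1 h

lemma memLp_snd_of_mem_transportPlans
    (hπ : π ∈ transportPlans (multivariateGaussian m₁ A) (multivariateGaussian m₂ B))
    (i : Fin d) : MemLp (fun p => p.2 i) 2 π := by
  have h := memLp_eval_multivariateGaussian (m := m₂) (A := B) i
  rw [← hπ.2] at h
  exact (memLp_map_measure_iff h.1 measurable_snd.aemeasurable).1 h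

lemma integral_fst_of_mem_transportPlans
    (hπ : π ∈ transportPlans (multivariateGaussian m₁ A) (multivariateGaussian m₂ B))
    {f : EuclideanSpace ℝ (Fin d) → ℝ} (hf : Continuous f) :
    ∫ p, f p.1 ∂π = ∫ x, f x ∂multivariateGaussian m₁ A := by
  rw [← hπ.1, integral_map measurable_fst.aemeasurable hf.aestronglyMeasurable]

lemma integral_snd_of_mem_transportPlans
    (hπ : π ∈ transportPlans (multivariateGaussian m₁ A) (multivariateGaussian m₂ B))
    {f : EuclideanSpace ℝ (Fin d) → ℝ} (hf : Continuous f) :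
    ∫ p, f p.2 ∂π = ∫ x, f x ∂multivariateGaussian m₂ B := by
  rw [← hπ.2, integral_map measurable_snd.aemeasurable hf.aestronglyMeasurable]

lemma isProbabilityMeasure_of_mem_transportPlans
    (hπ : π ∈ transportPlans (multivariateGaussian m₁ A) (multivariateGaussian m₂ B)) :
    IsProbabilityMeasure π := by
  constructor
  have h : (π.map Prod.fst) Set.univ = 1 := by rw [hπ.1]; exact measure_univ
  rwa [Measure.map_apply measurable_fst MeasurableSet.univ] at h

/-- The moments of a transport plan are feasible for every reference graph. -/
lemma isFeasible_of_mem_transportPlans (R : SimpleGraph (Fin d)) (hA : A.PosSemidef)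
    (hB : B.PosSemidef)
    (hπ : π ∈ transportPlans (multivariateGaussian m₁ A) (multivariateGaussian m₂ B)) :
    IsFeasible R m₁.ofLp m₂.ofLp A B (A + Matrix.vecMulVec m₁.ofLp m₁.ofLp)
      (B + Matrix.vecMulVec m₂.ofLp m₂.ofLp) (crossMoments π) := by
  have hsymm {S : Matrix (Fin d) (Fin d) ℝ} (hS : S.PosSemidef) (v : Fin d → ℝ) :
      (S + Matrix.vecMulVec v v).IsSymm := by
    ext i j
    have := hS.1.apply i j
    simp only [star_trivial] at this
    simp [Matrix.vecMulVec_apply, mul_comm, this]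
  refine ⟨hsymm hA _, hsymm hB _, rfl, rfl, ?_⟩
  have := isProbabilityMeasure_of_mem_transportPlans hπ
  refine posSemidef_of_integral_mul (π := π)
    (f := Sum.elim (fun _ _ => 1) (Sum.elim (fun i p => p.1 i) (fun i p => p.2 i))) ?_ ?_
  · rintro (i | i | i)
    · exact memLp_const 1
    · exact memLp_fst_of_mem_transportPlans hπ i
    · exact memLp_snd_of_mem_transportPlans hπ i
  · have e1 (i : Fin d) : ∫ p, p.1 i ∂π = m₁ i := by
      rw [integral_fst_of_mem_transportPlans hπ (f := fun x => x i) (by fun_prop),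
        integral_eval_multivariateGaussian]
    have e2 (i : Fin d) : ∫ p, p.2 i ∂π = m₂ i := by
      rw [integral_snd_of_mem_transportPlans hπ (f := fun x => x i) (by fun_prop),
        integral_eval_multivariateGaussian]
    have e11 (i j : Fin d) : ∫ p, p.1 i * p.1 j ∂π
        = (A + Matrix.vecMulVec m₁.ofLp m₁.ofLp) i j := by
      rw [integral_fst_of_mem_transportPlans hπ (f := fun x => x i * x j) (by fun_prop),
        integral_eval_mul_eval_multivariateGaussian hA]
    have e22 (i j : Fin d) : ∫ p, p.2 i * p.2 j ∂π
        = (B + Matrix.vecMulVec m₂.ofLp m₂.ofLp) i j := by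
      rw [integral_snd_of_mem_transportPlans hπ (f := fun x => x i * x j) (by fun_prop),
        integral_eval_mul_eval_multivariateGaussian hB]
    rintro (i | i | i) (j | j | j) <;>
      simp [momentMatrix, e1, e2, e11, e22, crossMoments, -Matrix.add_apply]
    simp_rw [mul_comm]

lemma lintegral_cost_of_mem_transportPlans (hA : A.PosSemidef) (hB : B.PosSemidef)
    (hπ : π ∈ transportPlans (multivariateGaussian m₁ A) (multivariateGaussian m₂ B)) :
    ∫⁻ p, ENNReal.ofReal (‖p.1 - p.2‖ ^ 2) ∂π =
      ENNReal.ofReal ((A + Matrix.vecMulVec m₁.ofLp m₁.ofLp).trace +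
        (B + Matrix.vecMulVec m₂.ofLp m₂.ofLp).trace - 2 * (crossMoments π).trace) := by
  have i1 (i : Fin d) : Integrable (fun p => p.1 i * p.1 i) π :=
    (memLp_fst_of_mem_transportPlans hπ i).integrable_mul (memLp_fst_of_mem_transportPlans hπ i)
  have i2 (i : Fin d) : Integrable (fun p => p.2 i * p.2 i) π :=
    (memLp_snd_of_mem_transportPlans hπ i).integrable_mul (memLp_snd_of_mem_transportPlans hπ i)
  have i3 (i : Fin d) : Integrable (fun p => 2 * (p.1 i * p.2 i)) π :=
    ((memLp_fst_of_mem_transportPlans hπ i).integrable_mul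
      (memLp_snd_of_mem_transportPlans hπ i)).const_mul 2
  have hexp (p : EuclideanSpace ℝ (Fin d) × EuclideanSpace ℝ (Fin d)) : ‖p.1 - p.2‖ ^ 2
      = ∑ i, (p.1 i * p.1 i + p.2 i * p.2 i - 2 * (p.1 i * p.2 i)) := by
    rw [EuclideanSpace.real_norm_sq_eq]
    refine Finset.sum_congr rfl fun i _ => ?_
    simp only [PiLp.sub_apply]
    ring
  have hint (i : Fin d) :
      Integrable (fun p => p.1 i * p.1 i + p.2 i * p.2 i - 2 * (p.1 i * p.2 i)) π :=
    ((i1 i).add (i2 i)).sub (i3 i)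
  rw [← ofReal_integral_eq_lintegral_ofReal]
  · congr 1
    simp_rw [hexp]
    rw [integral_finsetSum _ fun i _ => hint i]
    simp only [Matrix.trace, Finset.mul_sum, ← Finset.sum_add_distrib, ← Finset.sum_sub_distrib]
    refine Finset.sum_congr rfl fun i _ => ?_
    have i12 : Integrable (fun p => p.1 i * p.1 i + p.2 i * p.2 i) π := (i1 i).add (i2 i)
    rw [integral_sub i12 (i3 i), integral_add (i1 i) (i2 i),
      integral_const_mul,
      integral_fst_of_mem_transportPlans hπ (f := fun x => x i * x i) (by fun_prop),
      integral_snd_of_mem_transportPlans hπ (f := fun x => x i * x i) (by fun_prop),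
      integral_eval_mul_eval_multivariateGaussian hA,
      integral_eval_mul_eval_multivariateGaussian hB]
    simp [crossMoments]
  · simp_rw [hexp]
    exact integrable_finsetSum _ fun i _ => hint i
  · exact Filter.Eventually.of_forall fun p => sq_nonneg _

lemma relaxationOpt_le_toReal_wassersteinTwoSq (R : SimpleGraph (Fin d)) (hA : A.PosSemidef)
    (hB : B.PosSemidef)
    (hfin : wassersteinTwoSq (multivariateGaussian m₁ A) (multivariateGaussian m₂ B) ≠ ∞)
    (hleast : IsLeast (relaxationValues R m₁.ofLp m₂.ofLp A B)
      (relaxationOpt R m₁.ofLp m₂.ofLp A B)) :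
    relaxationOpt R m₁.ofLp m₂.ofLp A B ≤
      (wassersteinTwoSq (multivariateGaussian m₁ A) (multivariateGaussian m₂ B)).toReal := by
  rw [← ENNReal.ofReal_le_iff_le_toReal hfin]
  refine le_iInf₂ fun π hπ => ?_
  rw [lintegral_cost_of_mem_transportPlans hA hB hπ]
  exact ENNReal.ofReal_le_ofReal
    (hleast.2 ⟨_, _, _, isFeasible_of_mem_transportPlans R hA hB hπ, rfl⟩)

/-- If `T` is symmetric and `T A T = B`, the affine map `x ↦ (m₂ - T m₁) + T x` pushes
`N(m₁, A)` forward to `N(m₂, B)`. -/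
lemma map_affine_multivariateGaussian {T : Matrix (Fin d) (Fin d) ℝ} (hA : A.PosSemidef)
    (hB : B.PosSemidef) (hT : T.IsHermitian) (hTAT : T * A * T = B) :
    (multivariateGaussian m₁ A).map (fun x =>
      (m₂ - Matrix.toEuclideanCLM (𝕜 := ℝ) T m₁) + Matrix.toEuclideanCLM (𝕜 := ℝ) T x)
      = multivariateGaussian m₂ B := by
  set L := Matrix.toEuclideanCLM (𝕜 := ℝ) T with hL
  set c := m₂ - L m₁
  have hcomp : (multivariateGaussian m₁ A).map (fun x => c + L x)
      = ((multivariateGaussian m₁ A).map L).map (fun x => c + x) :=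
    (Measure.map_map (measurable_const_add c) (by fun_prop)).symm
  have hgauss : IsGaussian ((multivariateGaussian m₁ A).map (fun x => c + L x)) := by
    rw [hcomp]
    infer_instance
  have hadj : ContinuousLinearMap.adjoint L = L := by
    have h : star T = T := hT
    rw [← ContinuousLinearMap.star_eq_adjoint, hL, ← map_star, h]
  apply IsGaussian.ext
  · have hLint : Integrable (fun x => L x) (multivariateGaussian m₁ A) :=
      L.integrable_comp IsGaussian.integrable_id
    simp only [id_eq, integral_id_multivariateGaussian]
    rw [integral_map (by fun_prop) (by fun_prop),
      integral_add (integrable_const _) hLint,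
      integral_const, L.integral_comp_id_comm IsGaussian.integrable_id,
      integral_id_multivariateGaussian]
    simp [c]
  · ext u v
    rw [hcomp, covarianceBilin_map_const_add, covarianceBilin_map IsGaussian.memLp_two_id, hadj,
      covarianceBilin_multivariateGaussian hA, covarianceBilin_multivariateGaussian hB, hL,
      Matrix.ofLp_toEuclideanCLM, Matrix.ofLp_toEuclideanCLM, ← hTAT]
    have hT' : Tᵀ = T := by simpa using hT.eq
    rw [← Matrix.mulVec_mulVec, ← Matrix.mulVec_mulVec, Matrix.dotProduct_mulVec u.ofLp T,
      ← Matrix.mulVec_transpose, hT']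

/-- The cost of the affine transport map bounds the Wasserstein distance from above. -/
lemma wassersteinTwoSq_le {T : Matrix (Fin d) (Fin d) ℝ} (hA : A.PosSemidef)
    (hB : B.PosSemidef) (hT : T.IsHermitian) (hTAT : T * A * T = B) :
    wassersteinTwoSq (multivariateGaussian m₁ A) (multivariateGaussian m₂ B) ≤
      ENNReal.ofReal ((m₁.ofLp - m₂.ofLp) ⬝ᵥ (m₁.ofLp - m₂.ofLp) + A.trace + B.trace
        - 2 * (A * T).trace) := by
  set μ := multivariateGaussian m₁ A with hμ
  set L := Matrix.toEuclideanCLM (𝕜 := ℝ) T with hL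
  set c := m₂ - L m₁ with hc
  have hmeas : Measurable fun x : EuclideanSpace ℝ (Fin d) => (x, c + L x) := by fun_prop
  set π := μ.map fun x => (x, c + L x) with hπdef
  have hπ : π ∈ transportPlans μ (multivariateGaussian m₂ B) := by
    constructor
    · rw [hπdef, Measure.map_map measurable_fst hmeas]
      exact Measure.map_id
    · rw [hπdef, Measure.map_map measurable_snd hmeas]
      exact map_affine_multivariateGaussian hA hB hT hTAT
  have hT' : Tᵀ = T := by simpa using hT.eq
  have hcross : crossMoments π = A * T + Matrix.vecMulVec m₁.ofLp m₂.ofLp := by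
    ext i j
    have hLx (x : EuclideanSpace ℝ (Fin d)) : x i * (c + L x) j
        = x i * c j + ∑ k, T j k * (x i * x k) := by
      rw [PiLp.add_apply, hL, Matrix.ofLp_toEuclideanCLM, mul_add, Matrix.mulVec, dotProduct,
        Finset.mul_sum]
      congr 1
      exact Finset.sum_congr rfl fun k _ => by ring
    have i1 : Integrable (fun x : EuclideanSpace ℝ (Fin d) => x i * c j) μ :=
      ((memLp_eval_multivariateGaussian i).integrable (by norm_num)).mul_const _
    have i2 (k : Fin d) : Integrable (fun x : EuclideanSpace ℝ (Fin d) => T j k * (x i * x k)) μ :=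
      ((memLp_eval_multivariateGaussian i).integrable_mul
        (memLp_eval_multivariateGaussian k)).const_mul _
    have hcj : c j = m₂ j - ∑ k, T j k * m₁ k := by
      rw [hc, PiLp.sub_apply, hL, Matrix.ofLp_toEuclideanCLM]
      rfl
    calc crossMoments π i j = ∫ x, x i * (c + L x) j ∂μ := by
          rw [crossMoments, Matrix.of_apply, hπdef, integral_map hmeas.aemeasurable]
          exact Continuous.aestronglyMeasurable (by fun_prop)
      _ = m₁ i * c j + ∑ k, T j k * (A i k + m₁ i * m₁ k) := by
          simp_rw [hLx]
          rw [integral_add i1 (integrable_finsetSum _ fun k _ => i2 k),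
            integral_finsetSum _ fun k _ => i2 k, integral_mul_const,
            integral_eval_multivariateGaussian]
          congr 1
          refine Finset.sum_congr rfl fun k _ => ?_
          rw [integral_const_mul, integral_eval_mul_eval_multivariateGaussian hA,
            Matrix.add_apply, Matrix.vecMulVec_apply]
      _ = _ := by
          rw [hcj, Matrix.add_apply, Matrix.vecMulVec_apply, Matrix.mul_apply, mul_sub,
            Finset.mul_sum, sub_add, ← Finset.sum_sub_distrib, sub_eq_add_neg, add_comm,
            ← Finset.sum_neg_distrib]
          congr 1
          refine Finset.sum_congr rfl fun k _ => ?_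
          rw [← congrFun (congrFun hT' k) j, Matrix.transpose_apply]
          ring
  refine (iInf₂_le π hπ).trans ?_
  rw [lintegral_cost_of_mem_transportPlans hA hB hπ, hcross]
  refine ENNReal.ofReal_le_ofReal (le_of_eq ?_)
  simp only [Matrix.trace_add, Matrix.trace_vecMulVec, sub_dotProduct, dotProduct_sub]
  rw [dotProduct_comm m₂.ofLp m₁.ofLp]
  ring

end Couplings

/-! ### Accuracy of the relaxation -/

lemma SupportedWithin.apply_eq_zero {d h : ℕ} {G : SimpleGraph (Fin d)}
    {M : Matrix (Fin d) (Fin d) ℝ} (hM : SupportedWithin G h M) {i j : Fin d} (hij : i ≠ j)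
    (hadj : ¬ (graphPower G h).Adj i j) : M i j = 0 := by
  by_contra hne
  exact hadj ⟨hij, hM i j hne⟩

lemma trace_le_of_le_smul_one {d : ℕ} {A : Matrix (Fin d) (Fin d) ℝ} {b : ℝ} (h : A ≤ b • 1) :
    A.trace ≤ b * d := by
  have := (Matrix.le_iff.1 h).trace_nonneg
  rw [Matrix.trace_sub, Matrix.trace_smul, Matrix.trace_one, Fintype.card_fin, smul_eq_mul] at this
  linarith

lemma trace_mul_add_smul_one_le {d : ℕ} {A L T : Matrix (Fin d) (Fin d) ℝ} {b ε : ℝ}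
    (hA : A.PosSemidef) (hAb : A ≤ b • 1) (hε : 0 ≤ ε) (hLT : L ≤ T) :
    (A * (L + ε • (1 : Matrix (Fin d) (Fin d) ℝ))).trace ≤ (A * T).trace + ε * (b * d) := by
  have h1 := hA.trace_mul_nonneg (Matrix.le_iff.1 hLT)
  have h2 := mul_le_mul_of_nonneg_left (trace_le_of_le_smul_one hAb) hε
  rw [mul_sub, Matrix.trace_sub] at h1
  rw [mul_add, Matrix.trace_add, Matrix.mul_smul, mul_one, Matrix.trace_smul, smul_eq_mul]
  linarith

/-- With `q = b² / (a² + b²)` one has `1 - a² / b² ≤ q`, and `K = ⌊(h + 1) / 2⌋ ≥ h / 2`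
turns the truncation error into a power of `√q`. -/
lemma truncation_error_le {a b : ℝ} (ha : 0 < a) (hab : a ≤ b) (h : ℕ) :
    (1 - a ^ 2 / b ^ 2) ^ ((h + 1) / 2) / (a ^ 2 / b ^ 2) ≤
      b ^ 2 / a ^ 2 * ((√(b ^ 2 / (a ^ 2 + b ^ 2)))⁻¹) ^ (-(h : ℤ)) := by
  have hb : 0 < b := ha.trans_le hab
  set q := b ^ 2 / (a ^ 2 + b ^ 2) with hq
  have hq0 : 0 < q := by positivity
  have hq1 : q ≤ 1 := (div_le_one (by positivity)).2 (by nlinarith [sq_nonneg a])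
  have hl : a ^ 2 / b ^ 2 ≤ 1 := (div_le_one (by positivity)).2 (pow_le_pow_left₀ ha.le hab 2)
  have hlq : 1 - a ^ 2 / b ^ 2 ≤ q := by
    have h1 : q = 1 - a ^ 2 / (a ^ 2 + b ^ 2) := by
      rw [hq]
      field_simp
      ring
    rw [h1]
    gcongr
    nlinarith [sq_nonneg a]
  have hs0 : 0 ≤ √q := Real.sqrt_nonneg q
  have hs1 : √q ≤ 1 := Real.sqrt_le_one.2 hq1
  calc (1 - a ^ 2 / b ^ 2) ^ ((h + 1) / 2) / (a ^ 2 / b ^ 2)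
      = b ^ 2 / a ^ 2 * (1 - a ^ 2 / b ^ 2) ^ ((h + 1) / 2) := by
        field_simp
    _ ≤ b ^ 2 / a ^ 2 * q ^ ((h + 1) / 2) := by
        have := sub_nonneg.2 hl
        gcongr
    _ = b ^ 2 / a ^ 2 * √q ^ (2 * ((h + 1) / 2)) := by
        rw [pow_mul, Real.sq_sqrt hq0.le]
    _ ≤ b ^ 2 / a ^ 2 * √q ^ h := by
        gcongr b ^ 2 / a ^ 2 * ?_
        exact pow_le_pow_of_le_one hs0 hs1 (by omega)
    _ = _ := by rw [zpow_neg, zpow_natCast, inv_pow, inv_inv]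

lemma le_of_smul_one_le {d : ℕ} (hd : 0 < d) {A : Matrix (Fin d) (Fin d) ℝ} {a b : ℝ}
    (h₁ : (A - a • (1 : Matrix (Fin d) (Fin d) ℝ)).PosSemidef)
    (h₂ : (b • (1 : Matrix (Fin d) (Fin d) ℝ) - A).PosSemidef) : a ≤ b := by
  have e1 := h₁.diag_nonneg (i := ⟨0, hd⟩)
  have e2 := h₂.diag_nonneg (i := ⟨0, hd⟩)
  simp at e1 e2
  linarith

end GaussianOT

open scoped MatrixOrder in
theorem theorem3p1 (a b : ℝ) (ha : 0 < a) (hb : 0 < b) :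
    ∃ C ρ : ℝ, 0 < C ∧ 1 < ρ ∧
      ∀ (d : ℕ), 0 < d →
      ∀ (m₁ m₂ : EuclideanSpace ℝ (Fin d)) (S₁ S₂ : Matrix (Fin d) (Fin d) ℝ)
        (G : SimpleGraph (Fin d)),
        S₁.PosDef → S₂.PosDef →
        (S₁ - a • (1 : Matrix (Fin d) (Fin d) ℝ)).PosSemidef →
        (S₂ - a • (1 : Matrix (Fin d) (Fin d) ℝ)).PosSemidef →
        (b • (1 : Matrix (Fin d) (Fin d) ℝ) - S₁).PosSemidef →
        (b • (1 : Matrix (Fin d) (Fin d) ℝ) - S₂).PosSemidef →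
        S₁⁻¹ ∈ GaussianOT.sparseSymm G → S₂⁻¹ ∈ GaussianOT.sparseSymm G →
        -- both optimal values are genuine: `W₂²` is finite and the SDP minimum is attained
        GaussianOT.wassersteinTwoSq (multivariateGaussian m₁ S₁) (multivariateGaussian m₂ S₂) ≠ ∞ ∧
        (∀ R : SimpleGraph (Fin d),
          IsLeast (GaussianOT.relaxationValues R m₁.ofLp m₂.ofLp S₁ S₂)
            (GaussianOT.relaxationOpt R m₁.ofLp m₂.ofLp S₁ S₂)) ∧
        -- (i) exactness for the complete reference graph
        GaussianOT.relaxationOpt (⊤ : SimpleGraph (Fin d)) m₁.ofLp m₂.ofLp S₁ S₂ =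
          (GaussianOT.wassersteinTwoSq
            (multivariateGaussian m₁ S₁) (multivariateGaussian m₂ S₂)).toReal ∧
        -- (ii) exponential accuracy for the reference graph `G^h`
        ∀ h : ℕ,
          |GaussianOT.relaxationOpt (GaussianOT.graphPower G h) m₁.ofLp m₂.ofLp S₁ S₂ -
            (GaussianOT.wassersteinTwoSq
              (multivariateGaussian m₁ S₁) (multivariateGaussian m₂ S₂)).toReal| <
            C * (d : ℝ) ^ (3 / 2 : ℝ) * ρ ^ (-(h : ℤ)) := by
  set ρ : ℝ := (√(b ^ 2 / (a ^ 2 + b ^ 2)))⁻¹ with hρ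
  have hρ1 : 1 < ρ := by
    refine (one_lt_inv₀ (by positivity)).2 ((Real.sqrt_lt' one_pos).2 ?_)
    rw [one_pow, div_lt_one (by positivity)]
    nlinarith [pow_pos ha 2]
  -- the error is at most `2 b d ε` with `ε ≤ (b² / a²) ρ⁻ʰ`; the summand `1` makes it strict
  refine ⟨2 * b * (b ^ 2 / a ^ 2) + 1, ρ, by positivity, hρ1, ?_⟩
  intro d hd m₁ m₂ S₁ S₂ G hS₁ hS₂ ha₁ ha₂ hb₁ hb₂ hG₁ hG₂
  have hab : a ≤ b := GaussianOT.le_of_smul_one_le hd ha₁ hb₁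
  have hp₁ := hS₁.posSemidef
  have hp₂ := hS₂.posSemidef
  obtain ⟨T, U, hT, hU, hTU, hTAT, happrox⟩ :=
    GaussianOT.exists_transport_matrix hS₁ hS₂ ha hab ha₁ ha₂ hb₁ hb₂
  have hup := GaussianOT.wassersteinTwoSq_le (m₁ := m₁) (m₂ := m₂) hp₁ hp₂
    (Matrix.nonneg_iff_posSemidef.1 hT).1 hTAT
  set W := GaussianOT.wassersteinTwoSq (multivariateGaussian m₁ S₁) (multivariateGaussian m₂ S₂)
  set V := (m₁.ofLp - m₂.ofLp) ⬝ᵥ (m₁.ofLp - m₂.ofLp) + S₁.trace + S₂.trace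
    - 2 * (S₁ * T).trace with hV
  have hfin : W ≠ ∞ := ne_top_of_le_ne_top ENNReal.ofReal_ne_top hup
  have hleast (R : SimpleGraph (Fin d)) :
      IsLeast (GaussianOT.relaxationValues R m₁.ofLp m₂.ofLp S₁ S₂)
        (GaussianOT.relaxationOpt R m₁.ofLp m₂.ofLp S₁ S₂) := by
    -- a finite infimum over transport plans supplies a plan, whose moments are feasible
    obtain ⟨π, hπ⟩ : (GaussianOT.transportPlans (multivariateGaussian m₁ S₁)
        (multivariateGaussian m₂ S₂)).Nonempty := by
      by_contra hne
      rw [Set.not_nonempty_iff_eq_empty] at hne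
      exact hfin (by simp [W, GaussianOT.wassersteinTwoSq, hne])
    exact GaussianOT.isLeast_relaxationOpt
      ⟨_, _, _, _, GaussianOT.isFeasible_of_mem_transportPlans R hp₁ hp₂ hπ, rfl⟩
  have hle (R : SimpleGraph (Fin d)) :
      GaussianOT.relaxationOpt R m₁.ofLp m₂.ofLp S₁ S₂ ≤ W.toReal :=
    GaussianOT.relaxationOpt_le_toReal_wassersteinTwoSq R hp₁ hp₂ hfin (hleast R)
  have htrace : (S₂ * U).trace = (S₁ * T).trace := by
    rw [← hTAT, mul_assoc, hTU, mul_one, Matrix.trace_mul_comm]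
  have hTopV : V ≤ GaussianOT.relaxationOpt ⊤ m₁.ofLp m₂.ofLp S₁ S₂ := by
    obtain ⟨Z₁, Z₂, Y, hf, hval⟩ := (hleast ⊤).1
    rw [hval]
    refine le_trans (le_of_eq ?_) (GaussianOT.dual_bound hf hT hTU le_rfl le_rfl
      (fun i j hij hn => absurd hij hn) (fun i j hij hn => absurd hij hn))
    rw [hV, htrace]
    ring
  have hWV : W.toReal ≤ V := by
    -- `V = ‖m₁ - m₂‖² + Tr ((1 - T) S₁ (1 - T))`
    have hV0 : 0 ≤ V := by
      have hTh : (1 - T).IsHermitian :=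
        Matrix.isHermitian_one.sub (Matrix.nonneg_iff_posSemidef.1 hT).1
      have h := (hp₁.mul_mul_conjTranspose_same (1 - T)).trace_nonneg
      rw [hTh.eq, sub_mul, one_mul, mul_sub, mul_one, sub_mul, hTAT, Matrix.trace_sub,
        Matrix.trace_sub, Matrix.trace_sub, Matrix.trace_mul_comm T S₁] at h
      have hm : 0 ≤ (m₁.ofLp - m₂.ofLp) ⬝ᵥ (m₁.ofLp - m₂.ofLp) :=
        Finset.sum_nonneg fun i _ => mul_self_nonneg _
      linarith
    exact ENNReal.toReal_le_of_le_ofReal hV0 hup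
  refine ⟨hfin, hleast, le_antisymm (hle ⊤) (hWV.trans hTopV), fun h => ?_⟩
  obtain ⟨h1, h2, h3, h4⟩ := happrox ((h + 1) / 2)
  have herr := GaussianOT.truncation_error_le ha hab h
  rw [← hρ] at herr
  set ε := (1 - a ^ 2 / b ^ 2) ^ ((h + 1) / 2) / (a ^ 2 / b ^ 2)
  have hε : 0 ≤ ε := by
    have : a ^ 2 / b ^ 2 ≤ 1 :=
      (div_le_one (by positivity)).2 (pow_le_pow_left₀ ha.le hab 2)
    exact div_nonneg (pow_nonneg (sub_nonneg.2 this) _) (by positivity)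
  have hs₁ := GaussianOT.supportedWithin_one_of_mem_sparseSymm hG₁
  have hs₂ := GaussianOT.supportedWithin_one_of_mem_sparseSymm hG₂
  have hsT := (GaussianOT.supportedWithin_aeval hs₁ hs₂ hs₁ (a ^ 2) (K := (h + 1) / 2) (h := h)
    (by omega)).1.smul a
  have hsU := (GaussianOT.supportedWithin_aeval hs₁ hs₂ hs₂ (a ^ 2) (K := (h + 1) / 2) (h := h)
    (by omega)).2.smul a
  have hone := GaussianOT.SupportedWithin.one (G := G).mono (Nat.zero_le h)
  have hlow : V - 2 * (ε * (b * d)) ≤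
      GaussianOT.relaxationOpt (GaussianOT.graphPower G h) m₁.ofLp m₂.ofLp S₁ S₂ := by
    obtain ⟨Z₁, Z₂, Y, hf, hval⟩ := (hleast (GaussianOT.graphPower G h)).1
    rw [hval]
    have hdual := GaussianOT.dual_bound hf hT hTU h2 h4
      (fun i j hij hn => (hsT.add (hone.smul ε)).apply_eq_zero hij hn)
      (fun i j hij hn => (hsU.add (hone.smul ε)).apply_eq_zero hij hn)
    have e1 := GaussianOT.trace_mul_add_smul_one_le hp₁ hb₁ hε h1
    have e2 := GaussianOT.trace_mul_add_smul_one_le hp₂ hb₂ hε h3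
    rw [htrace] at e2
    linarith
  have hd1 : (1 : ℝ) ≤ d := by exact_mod_cast hd
  have hpow : (d : ℝ) ≤ (d : ℝ) ^ (3 / 2 : ℝ) := by
    simpa using Real.rpow_le_rpow_of_exponent_le hd1 (by norm_num : (1 : ℝ) ≤ 3 / 2)
  have hr : 0 < ρ ^ (-(h : ℤ)) := zpow_pos (zero_lt_one.trans hρ1) _
  rw [abs_of_nonpos (sub_nonpos.2 (hle _)), neg_sub]
  calc W.toReal - GaussianOT.relaxationOpt (GaussianOT.graphPower G h) m₁.ofLp m₂.ofLp S₁ S₂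
      ≤ 2 * (ε * (b * d)) := by linarith
    _ ≤ 2 * (b ^ 2 / a ^ 2 * ρ ^ (-(h : ℤ)) * (b * d)) := by gcongr
    _ = (2 * b * (b ^ 2 / a ^ 2)) * d * ρ ^ (-(h : ℤ)) := by ring
    _ < (2 * b * (b ^ 2 / a ^ 2) + 1) * d * ρ ^ (-(h : ℤ)) := by
        have : (0 : ℝ) < d := zero_lt_one.trans_le hd1
        gcongr
        linarith
    _ ≤ (2 * b * (b ^ 2 / a ^ 2) + 1) * (d : ℝ) ^ (3 / 2 : ℝ) * ρ ^ (-(h : ℤ)) := by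
        gcongr
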